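/- Let $d>1$ be a real number. In the Greedy$[d]$ process, balls are placed one after the other into $n$ initially empty bins. At each step rank the bins from heaviest to lightest, ties being broken by a fixed ordering of the bins; the next ball goes to the bin of rank $i$ with probability $(i/n)^d-((i-1)/n)^d$, independently of the past given the current loads (for an integer $d$: the least loaded of $d$ bins that are sampled uniformly and independently). Let $G^t$ be the gap after $tn$ balls have been placed, that is, the number of balls in the heaviest bin minus the average load $t$. Write $\log$ for the logarithm to base $2$. There are constants $\alpha,\gamma$, depending only on $d$ (so they are universal for the two-choice process $d=2$), such that for $t\ge\omega(\log n)$, $$\Pr\bigl[G^t\ \ge\ \log_d\log n+\alpha\log\log\log n+\gamma\bigr]\ \le\ \frac{2}{(\log\log n)^4}.$$ Here "for $t\ge\omega(\log n)$" means: for every function $f$ with $f(n)/\log n\to\infty$ there is an $N$ such that the bound holds for all $n\ge N$ and all integers $t\ge f(n)$. For $d=2$ the leading term $\log_d\log n$ is $\log\log n$. -/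

import Mathlib

noncomputable section

namespace BallsBins

/-- The rank of bin `i` in the load configuration `x`: the number of bins that are at least as heavy
as `i`, where ties are broken by the fixed ordering of the bins. The heaviest bin has rank `1`, the
lightest one has rank `n`. -/
def rank {n : ℕ} (x : Fin n → ℕ) (i : Fin n) : ℕ :=
  (Finset.univ.filter fun j : Fin n => x i < x j ∨ (x j = x i ∧ j ≤ i)).card

/-- The probability `(r/n)^d - ((r-1)/n)^d` that a ball is placed in bin `i`, where `r` is the rank
of `i`. Equivalently, one of the `r` heaviest bins is chosen with probability `(r/n)^d`. For an
integer `d` this is the law of the least loaded of `d` uniform and independent bins. -/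
def binProb (d : ℝ) {n : ℕ} (x : Fin n → ℕ) (i : Fin n) : ℝ :=
  ((rank x i : ℝ) / n) ^ d - (((rank x i : ℝ) - 1) / n) ^ d

theorem rank_pos {n : ℕ} (x : Fin n → ℕ) (i : Fin n) : 1 ≤ rank x i :=
  Finset.card_pos.mpr ⟨i, by simp⟩

theorem rank_le {n : ℕ} (x : Fin n → ℕ) (i : Fin n) : rank x i ≤ n := by
  simpa [rank] using Finset.card_le_univ
    (Finset.univ.filter fun j : Fin n => x i < x j ∨ (x j = x i ∧ j ≤ i))

theorem rank_lt {n : ℕ} (x : Fin n → ℕ) {i k : Fin n}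
    (h : x k < x i ∨ (x i = x k ∧ i < k)) : rank x i < rank x k := by
  apply Finset.card_lt_card
  refine Finset.ssubset_iff_of_subset (fun j hj => ?_) |>.mpr ⟨k, by simp, ?_⟩
  · simp only [Finset.mem_filter, Finset.mem_univ, true_and] at hj ⊢
    grind
  · simp only [Finset.mem_filter, Finset.mem_univ, true_and]
    grind

theorem rank_injective {n : ℕ} (x : Fin n → ℕ) : Function.Injective (rank x) := by
  intro i k h
  by_contra hne
  rcases lt_trichotomy (x i) (x k) with h1 | h1 | h1
  · exact absurd (rank_lt x (i := k) (k := i) (Or.inl h1)) (by omega)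
  · rcases lt_or_gt_of_ne hne with h2 | h2
    · exact absurd (rank_lt x (i := i) (k := k) (Or.inr ⟨h1, h2⟩)) (by omega)
    · exact absurd (rank_lt x (i := k) (k := i) (Or.inr ⟨h1.symm, h2⟩)) (by omega)
  · exact absurd (rank_lt x (i := i) (k := k) (Or.inl h1)) (by omega)

theorem image_rank {n : ℕ} (x : Fin n → ℕ) :
    Finset.univ.image (rank x) = Finset.Icc 1 n := by
  apply Finset.eq_of_subset_of_card_le
  · intro r hr
    obtain ⟨i, -, rfl⟩ := Finset.mem_image.mp hr
    exact Finset.mem_Icc.mpr ⟨rank_pos x i, rank_le x i⟩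
  · rw [Finset.card_image_of_injective _ (rank_injective x)]
    simp

theorem binProb_nonneg {d : ℝ} (hd : 1 < d) {n : ℕ} (x : Fin n → ℕ) (i : Fin n) :
    0 ≤ binProb d x i := by
  have h1 : (1 : ℝ) ≤ rank x i := by exact_mod_cast rank_pos x i
  refine sub_nonneg.mpr (Real.rpow_le_rpow (div_nonneg (by linarith) (by positivity)) ?_
    (by linarith))
  gcongr
  linarith

theorem sum_binProb {d : ℝ} (hd : 1 < d) {n : ℕ} [NeZero n] (x : Fin n → ℕ) :
    ∑ i, binProb d x i = 1 := by
  have hn : (n : ℝ) ≠ 0 := by exact_mod_cast NeZero.ne n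
  have h1 : ∑ i, binProb d x i
      = ∑ r ∈ Finset.Icc 1 n, (((r : ℝ) / n) ^ d - (((r : ℝ) - 1) / n) ^ d) := by
    rw [← image_rank x, Finset.sum_image (fun a _ b _ h => rank_injective x h)]
    rfl
  have h2 : Finset.Icc 1 n = Finset.Ico (0 + 1) (n + 1) := by
    ext
    simp only [Finset.mem_Icc, Finset.mem_Ico]
    omega
  rw [h1, h2, ← Finset.sum_Ico_add', ← Finset.range_eq_Ico]
  have h3 := Finset.sum_range_sub (fun r : ℕ => ((r : ℝ) / n) ^ d) n
  simp only [Nat.cast_add, Nat.cast_one, add_sub_cancel_right, Nat.cast_zero, zero_div,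
    div_self hn, Real.one_rpow, Real.zero_rpow (show d ≠ 0 by linarith), sub_zero] at h3 ⊢
  exact h3

/-- The law of the bin that receives the next ball, given the current loads. -/
def binLaw {d : ℝ} (hd : 1 < d) {n : ℕ} [NeZero n] (x : Fin n → ℕ) : PMF (Fin n) :=
  PMF.ofFintype (fun i => ENNReal.ofReal (binProb d x i)) (by
    rw [← ENNReal.ofReal_sum_of_nonneg fun i _ => binProb_nonneg hd x i, sum_binProb hd x,
      ENNReal.ofReal_one])

/-- The law of the vector of loads of the `n` bins after `m` balls have been placed, one after the
other, by the `Greedy[d]` rule, starting from empty bins. -/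
def loadLaw {d : ℝ} (hd : 1 < d) (n : ℕ) [NeZero n] : ℕ → PMF (Fin n → ℕ)
  | 0 => PMF.pure 0
  | m + 1 => (loadLaw hd n m).bind fun x =>
      (binLaw hd x).map fun i => Function.update x i (x i + 1)

/-- The gap: the number of balls in the heaviest bin minus the average load. -/
def gap {n : ℕ} (x : Fin n → ℕ) : ℝ :=
  ((Finset.univ.sup x : ℕ) : ℝ) - (∑ i, (x i : ℝ)) / n

/-- The probability that the gap `G^t`, after `t * n` balls have been placed in `n` bins, is at
least `s`. -/
def gapTail {d : ℝ} (hd : 1 < d) (n : ℕ) [NeZero n] (t : ℕ) (s : ℝ) : ℝ :=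
  (loadLaw hd n (t * n)).toMeasure.real {x | s ≤ gap x}

end BallsBins

end

/-!
The proof has two parts: exponential moments of the loads at a fixed time, and a layered induction
over the last rounds.

**Exponential moments.** Write `y i` for the load of bin `i` minus the average load. The potential
`∑ i, cosh (a * y i)` has expectation at most `2 * n` at all times, for a small `a` depending only
on `d`. To first order its expected increment is `a * ∑ i, (p i - 1 / n) * s i` with
`s i = sinh (a * y i)` and `p` the law of the next bin. Since `u ^ d ≤ u - c * u * (1 - u)` on
`[0, 1]`, Abel summation along the ranks compares this with the case of two choices, in which the
sum over the ranks is a symmetric expression: it is at most a negative multiple of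
`∑ i, ∑ j, |s i - s j|` (`sum_binProb_sub_mul_le`). The elementary inequality
`|sinh u - sinh v| ≥ sinh u / 2 * (1 - v / u)` for `u > 0` and all `v`, summed over `v = a * y j`,
shows that this double sum is at least `n / 2 * ∑ i, |s i|`, because the `y j` add up to zero
(`half_mul_abs_sinh_le_sum`). Hence the potential contracts once it exceeds `2 * n`
(`step_potential_le`). Consequently, at any time, the expected number of bins that exceed the
average by `l` is at most `4 * n * exp (-a * l)`.

**Layered induction.** Suppose that the gap is below `L` when `L * n` balls are still to come. Then
every ball above the final average is among these. If at most `β` bins reach the height `h`, then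
on average at most `L * n * (β / n) ^ d` of the balls land above `h`. With layer sizes that shrink
doubly exponentially, Markov's inequality for each layer shows that about `log_d log n` layers
above a base height `l` no bin is left; the base layer is small by the first part as soon as `l` is
of the order of `log L + log log log n` (`gapProb_add_le`). A first run with `L` of order `log n`
yields a gap of order `log log n`, and a second run with this `L` yields the claim
(`gapProb_le_of_two_runs`).

Expectations are computed with the iterates of the transition operator `step` on real-valued
functions of the configuration.
-/

noncomputable section

namespace BallsBins

open Finset

/-! ### The transition operator -/

/-- The one-step transition operator of the `Greedy[d]` chain: `step d F x` is the expected value of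
`F` after one ball has been added to the configuration `x`. The value of `(step d)^[m] F` at `x` is
the expected value of `F` after `m` balls. -/
def step (d : ℝ) {n : ℕ} (F : (Fin n → ℕ) → ℝ) (x : Fin n → ℕ) : ℝ :=
  ∑ i, binProb d x i * F (Function.update x i (x i + 1))

section Step

variable {d : ℝ} {n : ℕ}

theorem sum_update_succ (x : Fin n → ℕ) (i : Fin n) :
    ∑ j, Function.update x i (x i + 1) j = ∑ j, x j + 1 := by
  rw [Finset.sum_update_of_mem (mem_univ i), Finset.sdiff_singleton_eq_erase,
    ← Finset.add_sum_erase _ x (mem_univ i)]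
  omega

theorem step_mono (hd : 1 < d) {F G : (Fin n → ℕ) → ℝ} {x : Fin n → ℕ}
    (h : ∀ i, F (Function.update x i (x i + 1)) ≤ G (Function.update x i (x i + 1))) :
    step d F x ≤ step d G x :=
  Finset.sum_le_sum fun i _ => mul_le_mul_of_nonneg_left (h i) (binProb_nonneg hd x i)

theorem step_nonneg (hd : 1 < d) {F : (Fin n → ℕ) → ℝ} (h : ∀ x, 0 ≤ F x) (x : Fin n → ℕ) :
    0 ≤ step d F x :=
  Finset.sum_nonneg fun i _ => mul_nonneg (binProb_nonneg hd x i) (h _)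

/-- Monotonicity of the expectation after `m` balls; only the configurations with `m` more balls
matter. -/
theorem step_iterate_mono (hd : 1 < d) (m : ℕ) {F G : (Fin n → ℕ) → ℝ} {x : Fin n → ℕ}
    (h : ∀ y : Fin n → ℕ, ∑ j, y j = ∑ j, x j + m → F y ≤ G y) :
    (step d)^[m] F x ≤ (step d)^[m] G x := by
  induction m generalizing x with
  | zero => exact h x rfl
  | succ m ih =>
    rw [Function.iterate_succ_apply', Function.iterate_succ_apply']
    refine step_mono hd fun i => ih fun y hy => h y ?_
    rw [hy, sum_update_succ]
    ring

theorem step_add (F G : (Fin n → ℕ) → ℝ) :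
    step d (fun y => F y + G y) = fun y => step d F y + step d G y := by
  funext x
  simp [step, mul_add, Finset.sum_add_distrib]

theorem step_const_mul (c : ℝ) (F : (Fin n → ℕ) → ℝ) :
    step d (fun y => c * F y) = fun y => c * step d F y := by
  funext x
  simp only [step, Finset.mul_sum]
  exact Finset.sum_congr rfl fun i _ => by ring

theorem step_const [NeZero n] (hd : 1 < d) (c : ℝ) :
    step d (fun _ : Fin n → ℕ => c) = fun _ => c := by
  funext x
  rw [step, ← Finset.sum_mul, sum_binProb hd, one_mul]

theorem step_iterate_add (m : ℕ) (F G : (Fin n → ℕ) → ℝ) :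
    (step d)^[m] (fun y => F y + G y) = fun y => (step d)^[m] F y + (step d)^[m] G y := by
  induction m with
  | zero => rfl
  | succ m ih => simp only [Function.iterate_succ_apply', ih, step_add]

theorem step_iterate_const_mul (m : ℕ) (c : ℝ) (F : (Fin n → ℕ) → ℝ) :
    (step d)^[m] (fun y => c * F y) = fun y => c * (step d)^[m] F y := by
  induction m with
  | zero => rfl
  | succ m ih => simp only [Function.iterate_succ_apply', ih, step_const_mul]

theorem step_iterate_const [NeZero n] (hd : 1 < d) (m : ℕ) (c : ℝ) :
    (step d)^[m] (fun _ : Fin n → ℕ => c) = fun _ => c := by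
  induction m with
  | zero => rfl
  | succ m ih => rw [Function.iterate_succ_apply', ih, step_const hd]

/-- Expectations under `loadLaw` are iterates of `step` at the empty configuration. -/
theorem tsum_loadLaw_mul [NeZero n] (hd : 1 < d) (m : ℕ) {F : (Fin n → ℕ) → ℝ}
    (hF : ∀ x, 0 ≤ F x) :
    ∑' x, loadLaw hd n m x * ENNReal.ofReal (F x) = ENNReal.ofReal ((step d)^[m] F 0) := by
  induction m generalizing F with
  | zero =>
    rw [tsum_eq_single 0 fun x hx => by simp [loadLaw, PMF.pure_apply, hx]]
    simp [loadLaw, PMF.pure_apply]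
  | succ m ih =>
    rw [Function.iterate_succ_apply, ← ih (step_nonneg hd hF)]
    simp only [loadLaw, PMF.bind_apply, ← ENNReal.tsum_mul_right]
    rw [ENNReal.tsum_comm]
    refine tsum_congr fun x => ?_
    simp only [mul_assoc, ENNReal.tsum_mul_left]
    congr 1
    simp only [PMF.map_apply, ← ENNReal.tsum_mul_right]
    rw [ENNReal.tsum_comm, tsum_fintype, step,
      ENNReal.ofReal_sum_of_nonneg fun i _ => mul_nonneg (binProb_nonneg hd x i) (hF _)]
    refine Finset.sum_congr rfl fun i _ => ?_
    rw [tsum_eq_single (Function.update x i (x i + 1)) fun y hy => by simp [hy], if_pos rfl,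
      ENNReal.ofReal_mul (binProb_nonneg hd x i)]
    rfl

theorem loadLaw_toMeasure_real [NeZero n] (hd : 1 < d) (m : ℕ) (S : Set (Fin n → ℕ)) :
    (loadLaw hd n m).toMeasure.real S = (step d)^[m] (S.indicator fun _ => 1) 0 := by
  have hS : MeasurableSet S := S.to_countable.measurableSet
  have h0 : ∀ x, 0 ≤ S.indicator (fun _ => (1 : ℝ)) x :=
    Set.indicator_nonneg fun _ _ => zero_le_one
  have h1 : 0 ≤ (step d)^[m] (S.indicator fun _ => (1 : ℝ)) (0 : Fin n → ℕ) := by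
    have := step_iterate_mono hd m (x := 0) (F := fun _ => (0 : ℝ)) fun y _ => h0 y
    rwa [step_iterate_const hd] at this
  rw [MeasureTheory.measureReal_def, PMF.toMeasure_apply _ hS, ← ENNReal.toReal_ofReal h1,
    ← tsum_loadLaw_mul hd m h0]
  congr 1
  refine tsum_congr fun x => ?_
  by_cases hx : x ∈ S <;> simp [hx]

end Step

/-! ### The exponential potential -/

/-- Since `u ^ d` is convex and not linear on `[0, 1]`, it lies below the chord by at least a
multiple of `u * (1 - u)`. -/
theorem rpow_le_sub_mul {d : ℝ} (hd : 1 < d) {u : ℝ} (h0 : 0 ≤ u) (h1 : u ≤ 1) :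
    u ^ d ≤ u - min 1 (d - 1) * (u * (1 - u)) := by
  have hc : 0 < min 1 (d - 1) := lt_min one_pos (by linarith)
  rcases h0.eq_or_lt with rfl | hu
  · simp [Real.zero_rpow (show d ≠ 0 by linarith)]
  · have h2 : u ^ (d - 1) ≤ u ^ (min 1 (d - 1)) :=
      Real.rpow_le_rpow_of_exponent_ge hu h1 (min_le_right _ _)
    have h3 := rpow_one_add_le_one_add_mul_self (s := u - 1) (by linarith) hc.le
      (min_le_left 1 (d - 1))
    rw [show 1 + (u - 1) = u by ring] at h3
    have h4 : u ^ d = u * u ^ (d - 1) := by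
      rw [Real.rpow_sub_one hu.ne']
      field_simp
    rw [h4]
    nlinarith [mul_le_mul_of_nonneg_left (h2.trans h3) h0]

theorem binProb_le {d : ℝ} (hd : 1 < d) {n : ℕ} [NeZero n] (x : Fin n → ℕ) (i : Fin n) :
    binProb d x i ≤ d / n := by
  have hn : (0 : ℝ) < n := by exact_mod_cast Nat.pos_of_ne_zero (NeZero.ne n)
  have hr : (1 : ℝ) ≤ rank x i := by exact_mod_cast rank_pos x i
  have hr' : (rank x i : ℝ) ≤ n := by exact_mod_cast rank_le x i
  set u : ℝ := rank x i / n with hu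
  have hu0 : 0 < u := by positivity
  have hu1 : u ≤ 1 := (div_le_one hn).mpr hr'
  -- Bernoulli's inequality for the ratio of the two powers
  have h1 := one_add_mul_self_le_rpow_one_add (s := -(1 / rank x i : ℝ))
    (by rw [neg_le_neg_iff, div_le_one (by linarith)]; exact hr) hd.le
  have h2 : ((rank x i : ℝ) - 1) / n = u * (1 + -(1 / rank x i : ℝ)) := by
    rw [hu]
    field_simp
    ring
  have h3 : (0 : ℝ) ≤ 1 + -(1 / rank x i : ℝ) := by
    have : 1 / (rank x i : ℝ) ≤ 1 := (div_le_one (by linarith)).mpr hr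
    linarith
  rw [binProb, h2, Real.mul_rpow hu0.le h3]
  have h4 : u ^ d ≤ u := by
    simpa using Real.rpow_le_rpow_of_exponent_ge hu0 hu1 hd.le
  have h5 : u * (d * (1 / rank x i)) = d / n := by
    rw [hu]
    field_simp
  have h6 : 0 ≤ u ^ d := by positivity
  have h7 : 0 ≤ d * (1 / (rank x i : ℝ)) := by positivity
  nlinarith [mul_le_mul_of_nonneg_left h1 h6, mul_le_mul_of_nonneg_right h4 h7]

theorem sum_comp_rank {n : ℕ} (x : Fin n → ℕ) (g : ℕ → ℝ) :
    ∑ i, g (rank x i) = ∑ r ∈ Icc 1 n, g r := by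
  rw [← image_rank x, Finset.sum_image fun a _ b _ h => rank_injective x h]

/-- Abel summation: weights with nonpositive partial sums `D` pair nonpositively with an antitone
sequence. -/
theorem sum_sub_mul_le_of_antitone {D s : ℕ → ℝ} {n : ℕ} (h0 : D 0 = 0)
    (hD : ∀ k ≤ n, D k ≤ 0) (hs : ∀ r, 1 ≤ r → r < n → s (r + 1) ≤ s r) :
    ∀ m ≤ n, ∑ r ∈ Icc 1 m, (D r - D (r - 1)) * s r ≤ D m * s m := by
  intro m
  induction m with
  | zero => simp [h0]
  | succ m ih =>
    intro hm
    rw [Finset.sum_Icc_succ_top (by omega)]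
    rcases Nat.eq_zero_or_pos m with rfl | hm0
    · simp [h0]
    · -- the new boundary term absorbs `D m * (s m - s (m + 1)) ≤ 0`
      have h1 := ih (by omega)
      have h2 := hs m hm0 (by omega)
      have h3 := hD m (by omega)
      simp only [Nat.add_sub_cancel]
      nlinarith

theorem exists_rank_eq {n : ℕ} (x : Fin n → ℕ) {r : ℕ} (h1 : 1 ≤ r) (h2 : r ≤ n) :
    ∃ i, rank x i = r := by
  have : r ∈ Finset.univ.image (rank x) := by
    rw [image_rank]
    exact Finset.mem_Icc.mpr ⟨h1, h2⟩
  simpa using this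

theorem load_le_of_rank_le {n : ℕ} (x : Fin n → ℕ) {i j : Fin n} (h : rank x i ≤ rank x j) :
    x j ≤ x i := by
  by_contra hlt
  exact absurd (rank_lt x (i := j) (k := i) (Or.inl (by omega))) (by omega)

/-- For an observable `s` that increases with the load, the signs of the differences of `s` are
those of the differences of the ranks, so that the sum of all distances is linear in `s`. -/
theorem sum_sum_abs_sub {n : ℕ} (x : Fin n → ℕ) {s : Fin n → ℝ}
    (hs : ∀ i j, x j ≤ x i → s j ≤ s i) :
    ∑ i, ∑ j, |s i - s j| = 2 * ∑ i, s i * (n + 1 - 2 * rank x i) := by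
  -- the sign of `rank x j - rank x i`
  set σ : Fin n → Fin n → ℝ := fun i j =>
    (if rank x i ≤ rank x j then 1 else 0) - (if rank x j ≤ rank x i then 1 else 0) with hσ
  have h1 : ∀ i j, |s i - s j| = σ i j * s i + σ j i * s j := by
    intro i j
    simp only [hσ]
    rcases lt_trichotomy (rank x i) (rank x j) with h | h | h
    · have := hs i j (load_le_of_rank_le x h.le)
      rw [abs_of_nonneg (by linarith)]
      simp [h.le, h.not_ge]
      ring
    · have := rank_injective x h
      subst this
      simp
    · have := hs j i (load_le_of_rank_le x h.le)
      rw [abs_of_nonpos (by linarith)]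
      simp [h.le, h.not_ge]
      ring
  have h2 : ∀ i, ∑ j, σ i j = n + 1 - 2 * rank x i := by
    intro i
    have h3 := rank_pos x i
    have h4 := rank_le x i
    simp only [hσ, Finset.sum_sub_distrib]
    rw [sum_comp_rank x fun r => if rank x i ≤ r then (1 : ℝ) else 0,
      sum_comp_rank x fun r => if r ≤ rank x i then (1 : ℝ) else 0, Finset.sum_boole,
      Finset.sum_boole]
    have h5 : (Icc 1 n).filter (fun r => rank x i ≤ r) = Icc (rank x i) n := by
      ext r
      simp only [Finset.mem_filter, Finset.mem_Icc]
      omega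
    have h6 : (Icc 1 n).filter (fun r => r ≤ rank x i) = Icc 1 (rank x i) := by
      ext r
      simp only [Finset.mem_filter, Finset.mem_Icc]
      omega
    rw [h5, h6, Nat.card_Icc, Nat.card_Icc, Nat.cast_sub (by omega)]
    push_cast
    ring
  simp only [h1, Finset.sum_add_distrib]
  rw [Finset.sum_comm (f := fun i j => σ j i * s j), ← two_mul]
  congr 1
  refine Finset.sum_congr rfl fun i _ => ?_
  rw [← Finset.sum_mul, h2, mul_comm]

/-- The bias of the process towards light bins, measured by an observable that increases with the
load. -/
theorem sum_binProb_sub_mul_le {d : ℝ} (hd : 1 < d) {n : ℕ} [NeZero n] (x : Fin n → ℕ)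
    {s : Fin n → ℝ} (hs : ∀ i j, x j ≤ x i → s j ≤ s i) :
    ∑ i, (binProb d x i - 1 / n) * s i
      ≤ -(min 1 (d - 1) / (2 * n ^ 2)) * ∑ i, ∑ j, |s i - s j| := by
  have hn : (0 : ℝ) < n := by exact_mod_cast Nat.pos_of_ne_zero (NeZero.ne n)
  set c := min 1 (d - 1)
  set D : ℕ → ℝ := fun k => ((k : ℝ) / n) ^ d - k / n + c * (k / n * (1 - k / n)) with hDdef
  -- `b r` is the bin of rank `r`
  choose! b hb using fun (r : ℕ) (h : 1 ≤ r ∧ r ≤ n) => exists_rank_eq x h.1 h.2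
  have hbr : ∀ i, b (rank x i) = i := fun i =>
    rank_injective x (hb _ ⟨rank_pos x i, rank_le x i⟩)
  have hD0 : D 0 = 0 := by simp [hDdef, Real.zero_rpow (show d ≠ 0 by linarith)]
  have hDn : D n = 0 := by simp [hDdef]
  have h1 := sum_sub_mul_le_of_antitone (D := D) (s := fun r => s (b r)) hD0
    (fun k hk => by
      have := rpow_le_sub_mul hd (u := (k : ℝ) / n) (by positivity)
        ((div_le_one hn).mpr (by exact_mod_cast hk))
      simp only [hDdef]
      linarith)
    (fun r hr1 hr2 => hs _ _ (load_le_of_rank_le x (by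
      rw [hb r ⟨hr1, hr2.le⟩, hb (r + 1) ⟨by omega, hr2⟩]
      omega))) n le_rfl
  rw [hDn, zero_mul, ← sum_comp_rank x] at h1
  simp only [hbr] at h1
  rw [sum_sum_abs_sub x hs]
  have h2 : ∀ i, (D (rank x i) - D (rank x i - 1)) * s i
      = (binProb d x i - 1 / n) * s i + c / n ^ 2 * (s i * (n + 1 - 2 * rank x i)) := by
    intro i
    simp only [hDdef, binProb]
    rw [Nat.cast_sub (rank_pos x i)]
    push_cast
    field_simp
    ring
  simp only [h2, Finset.sum_add_distrib, ← Finset.mul_sum] at h1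
  have h3 : -(c / (2 * (n : ℝ) ^ 2)) * (2 * ∑ i, s i * (n + 1 - 2 * rank x i))
      = -(c / n ^ 2 * ∑ i, s i * (n + 1 - 2 * rank x i)) := by
    field_simp
  rw [h3]
  linarith

theorem convexOn_sinh : ConvexOn ℝ (Set.Ici 0) Real.sinh := by
  refine MonotoneOn.convexOn_of_deriv (convex_Ici 0) Real.continuous_sinh.continuousOn
    Real.differentiable_sinh.differentiableOn ?_
  rw [Real.deriv_sinh, interior_Ici]
  intro u hu v hv huv
  rw [Set.mem_Ioi] at hu hv
  rwa [Real.cosh_le_cosh, abs_of_pos hu, abs_of_pos hv]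

/-- By convexity `sinh` lies below its chord over `[0, u]`, which gives the bound for `v` between
`0` and `u`; for the other `v` it follows from the symmetry of `sinh`. -/
theorem sinh_mul_one_sub_div_le {u : ℝ} (hu : 0 < u) (v : ℝ) :
    Real.sinh u / 2 * (1 - v / u) ≤ |Real.sinh u - Real.sinh v| := by
  have hsu : 0 < Real.sinh u := Real.sinh_pos_iff.mpr hu
  have hconv : ∀ a b : ℝ, 0 ≤ a → a ≤ b → 0 < b → Real.sinh a ≤ a / b * Real.sinh b := by
    intro a b ha hab hb
    have h := convexOn_sinh.2 (Set.mem_Ici.mpr le_rfl) (Set.mem_Ici.mpr hb.le)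
      (sub_nonneg.mpr ((div_le_one hb).mpr hab)) (div_nonneg ha hb.le) (sub_add_cancel 1 (a / b))
    simpa [div_mul_cancel₀ a hb.ne'] using h
  rcases le_total u v with huv | huv
  · have : 1 ≤ v / u := (one_le_div hu).mpr huv
    exact le_trans (by nlinarith) (abs_nonneg _)
  · refine le_trans ?_ (le_abs_self _)
    rcases le_total 0 v with hv | hv
    · have h1 := hconv v u hv huv hu
      have h2 : v / u ≤ 1 := (div_le_one hu).mpr huv
      nlinarith
    · have hsv : Real.sinh v ≤ 0 := Real.sinh_nonpos_iff.mpr hv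
      rcases le_total (-v) u with h | h
      · have h2 : -(v / u) ≤ 1 := by rw [← neg_div]; exact (div_le_one hu).mpr h
        nlinarith
      · have h1 := hconv u (-v) hu.le h (by linarith)
        rw [Real.sinh_neg] at h1
        have h3 : Real.sinh u * (-v / u) ≤ - Real.sinh v := by
          have hv' : 0 < -v := by linarith
          calc Real.sinh u * (-v / u) ≤ (u / -v * -Real.sinh v) * (-v / u) := by gcongr
            _ = -Real.sinh v := by
              have := hv'.ne'
              have := hu.ne'
              have : v ≠ 0 := by linarith
              field_simp
        rw [neg_div] at h3
        have : 1 ≤ -(v / u) := by rw [← neg_div]; exact (one_le_div hu).mpr h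
        nlinarith

/-- Averaging over `j`, the linear terms on the left side of `sinh_mul_one_sub_div_le` cancel if the
`y j` add up to zero. -/
theorem half_mul_abs_sinh_le_sum {n : ℕ} {y : Fin n → ℝ} (hy : ∑ j, y j = 0) (i : Fin n) :
    n / 2 * |Real.sinh (y i)| ≤ ∑ j, |Real.sinh (y i) - Real.sinh (y j)| := by
  have key : ∀ (u : ℝ) (v : Fin n → ℝ), 0 < u → ∑ j, v j = 0 →
      n / 2 * Real.sinh u ≤ ∑ j, |Real.sinh u - Real.sinh (v j)| := by
    intro u v hu hv
    refine le_trans (le_of_eq ?_) (Finset.sum_le_sum fun j _ => sinh_mul_one_sub_div_le hu (v j))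
    rw [← Finset.mul_sum, Finset.sum_sub_distrib, ← Finset.sum_div, hv]
    simp
    ring
  rcases lt_trichotomy (y i) 0 with h | h | h
  · have h1 := key (-y i) (fun j => -y j) (by linarith)
      (by rw [Finset.sum_neg_distrib, hy, neg_zero])
    rw [abs_of_neg (Real.sinh_neg_iff.mpr h), ← Real.sinh_neg]
    refine h1.trans_eq (Finset.sum_congr rfl fun j _ => ?_)
    rw [Real.sinh_neg, Real.sinh_neg, ← abs_neg]
    congr 1
    ring
  · rw [h, Real.sinh_zero, abs_zero, mul_zero]
    exact Finset.sum_nonneg fun j _ => abs_nonneg _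
  · rw [abs_of_pos (Real.sinh_pos_iff.mpr h)]
    exact key _ _ h hy

theorem cosh_add_le (u : ℝ) {v : ℝ} (hv : |v| ≤ 1) :
    Real.cosh (u + v) ≤ Real.cosh u + v * Real.sinh u + v ^ 2 * Real.cosh u := by
  have h1 := (abs_le.mp (Real.abs_exp_sub_one_sub_id_le hv)).2
  have h2 := (abs_le.mp (Real.abs_exp_sub_one_sub_id_le (x := -v) (by rwa [abs_neg]))).2
  have h3 := mul_le_mul_of_nonneg_left h1 (Real.exp_pos u).le
  have h4 := mul_le_mul_of_nonneg_left h2 (Real.exp_pos (-u)).le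
  rw [Real.cosh_eq, Real.cosh_eq, Real.sinh_eq, neg_add, Real.exp_add, Real.exp_add]
  nlinarith

/-- The load of bin `i` minus the average load. -/
def dev {n : ℕ} (x : Fin n → ℕ) (i : Fin n) : ℝ :=
  x i - (∑ j, (x j : ℝ)) / n

theorem sum_dev {n : ℕ} [NeZero n] (x : Fin n → ℕ) : ∑ i, dev x i = 0 := by
  have hn : (n : ℝ) ≠ 0 := by exact_mod_cast NeZero.ne n
  simp only [dev, Finset.sum_sub_distrib, Finset.sum_const, Finset.card_univ, Fintype.card_fin,
    nsmul_eq_mul]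
  field_simp
  ring

theorem dev_update {n : ℕ} (x : Fin n → ℕ) (i j : Fin n) :
    dev (Function.update x i (x i + 1)) j = dev x j + ((if j = i then 1 else 0) - 1 / n) := by
  have h : ∑ k, ((Function.update x i (x i + 1) k : ℕ) : ℝ) = ∑ k, (x k : ℝ) + 1 := by
    exact_mod_cast sum_update_succ x i
  rw [dev, dev, h]
  by_cases hj : j = i
  · subst hj
    simp
    ring
  · simp [hj]
    ring

/-- The two-sided exponential potential, at scale `a`. -/
def potential (a : ℝ) {n : ℕ} (x : Fin n → ℕ) : ℝ :=
  ∑ i, Real.cosh (a * dev x i)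

/-- The scale at which the first-order gain of the potential beats the second-order loss. -/
def scale (d : ℝ) : ℝ := min 1 (d - 1) / (8 * (d + 1))

/-- The rate at which the potential contracts. -/
def rate (d : ℝ) : ℝ := scale d * min 1 (d - 1) / 8

section Potential

variable {d : ℝ} {n : ℕ} [NeZero n]

theorem scale_pos (hd : 1 < d) : 0 < scale d :=
  div_pos (lt_min one_pos (by linarith)) (by linarith)

theorem scale_le_one (hd : 1 < d) : scale d ≤ 1 := by
  have : min 1 (d - 1) ≤ 1 := min_le_left _ _
  rw [scale, div_le_one (by linarith)]
  linarith

theorem rate_le_one (hd : 1 < d) : rate d ≤ 1 := by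
  have h1 : min 1 (d - 1) ≤ 1 := min_le_left _ _
  have h2 : 0 < min 1 (d - 1) := lt_min one_pos (by linarith)
  have h3 := scale_le_one hd
  have h4 := scale_pos hd
  rw [rate]
  nlinarith

/-- The expected potential after one ball, up to second order: the increments of the deviation of
bin `i` have mean `binProb d x i - 1 / n` and second moment at most `binProb d x i + 1 / n`. -/
theorem step_potential_le_taylor (hd : 1 < d) {a : ℝ} (ha0 : 0 ≤ a) (ha1 : a ≤ 1)
    (x : Fin n → ℕ) :
    step d (potential a) x ≤ potential a x
      + a * ∑ i, (binProb d x i - 1 / n) * Real.sinh (a * dev x i)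
      + a ^ 2 * ((d + 1) / n) * potential a x := by
  have hn : (1 : ℝ) ≤ n := by exact_mod_cast Nat.one_le_iff_ne_zero.mpr (NeZero.ne n)
  have hn0 : (0 : ℝ) < n := by linarith
  have hn1 : 1 / (n : ℝ) ≤ 1 := (div_le_one hn0).mpr hn
  have hn2 : 0 < 1 / (n : ℝ) := by positivity
  set C : Fin n → ℝ := fun i => Real.cosh (a * dev x i) with hC
  set S : Fin n → ℝ := fun i => Real.sinh (a * dev x i) with hS
  have hCpos : ∀ i, 0 < C i := fun i => Real.cosh_pos _
  have h1 : ∀ i j, Real.cosh (a * dev (Function.update x i (x i + 1)) j)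
      ≤ C j + (if j = i then a * S j + a ^ 2 * C j else 0) - a / n * S j
        + a ^ 2 / n * C j := by
    intro i j
    rw [dev_update, mul_add]
    have hδ : |a * ((if j = i then (1 : ℝ) else 0) - 1 / n)| ≤ 1 := by
      rw [abs_mul, abs_of_nonneg ha0]
      refine mul_le_one₀ ha1 (abs_nonneg _) ?_
      split_ifs <;> rw [abs_le] <;> constructor <;> linarith
    refine (cosh_add_le _ hδ).trans ?_
    have h2 : ((if j = i then (1 : ℝ) else 0) - 1 / n) ^ 2 ≤ (if j = i then 1 else 0) + 1 / n := by
      split_ifs <;> nlinarith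
    have h3 := mul_le_mul_of_nonneg_left h2 (mul_nonneg (sq_nonneg a) (hCpos j).le)
    have h4 : a / (n : ℝ) = a * (1 / n) := by ring
    have h5 : a ^ 2 / (n : ℝ) = a ^ 2 * (1 / n) := by ring
    rw [h4, h5]
    simp only [hC, hS] at h3 ⊢
    split_ifs at h3 ⊢ <;> linarith
  have h2 : ∀ i, potential a (Function.update x i (x i + 1))
      ≤ ((1 + a ^ 2 / n) * potential a x - a / n * ∑ j, S j) + (a * S i + a ^ 2 * C i) := by
    intro i
    refine (Finset.sum_le_sum fun j _ => h1 i j).trans_eq ?_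
    simp only [Finset.sum_add_distrib, Finset.sum_sub_distrib, ← Finset.mul_sum,
      Finset.sum_ite_eq', Finset.mem_univ, if_true]
    simp only [potential, hC]
    ring
  calc step d (potential a) x
      ≤ ∑ i, binProb d x i * (((1 + a ^ 2 / n) * potential a x - a / n * ∑ j, S j)
          + (a * S i + a ^ 2 * C i)) :=
        Finset.sum_le_sum fun i _ => mul_le_mul_of_nonneg_left (h2 i) (binProb_nonneg hd x i)
    _ = ((1 + a ^ 2 / n) * potential a x - a / n * ∑ j, S j)
          + a * ∑ i, binProb d x i * S i + a ^ 2 * ∑ i, binProb d x i * C i := by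
        simp only [mul_add, Finset.sum_add_distrib, ← Finset.sum_mul, sum_binProb hd x]
        simp only [mul_left_comm _ a, mul_left_comm _ (a ^ 2), ← Finset.mul_sum]
        ring
    _ ≤ ((1 + a ^ 2 / n) * potential a x - a / n * ∑ j, S j)
          + a * ∑ i, binProb d x i * S i + a ^ 2 * (d / n * potential a x) := by
        have : ∑ i, binProb d x i * C i ≤ d / n * potential a x := by
          rw [potential, Finset.mul_sum]
          exact Finset.sum_le_sum fun i _ =>
            mul_le_mul_of_nonneg_right (binProb_le hd x i) (hCpos i).le
        gcongr
    _ = _ := by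
        simp only [sub_mul, Finset.sum_sub_distrib, ← Finset.mul_sum]
        ring

/-- The drift of the potential: it contracts as soon as it exceeds `2 * n`. -/
theorem step_potential_le (hd : 1 < d) (x : Fin n → ℕ) :
    step d (potential (scale d)) x
      ≤ (1 - rate d / n) * potential (scale d) x + 2 * rate d := by
  have hn0 : (0 : ℝ) < n := by exact_mod_cast Nat.pos_of_ne_zero (NeZero.ne n)
  have ha := scale_pos hd
  have hc : 0 < min 1 (d - 1) := lt_min one_pos (by linarith)
  have h1 := step_potential_le_taylor hd ha.le (scale_le_one hd) x
  have h2 := sum_binProb_sub_mul_le hd x (s := fun i => Real.sinh (scale d * dev x i))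
    fun i j hij => Real.sinh_le_sinh.mpr (mul_le_mul_of_nonneg_left
      (sub_le_sub_right (by exact_mod_cast hij) _) ha.le)
  have h3 : (n : ℝ) / 2 * (potential (scale d) x - n)
      ≤ ∑ i, ∑ j, |Real.sinh (scale d * dev x i) - Real.sinh (scale d * dev x j)| := by
    calc (n : ℝ) / 2 * (potential (scale d) x - n)
        = ∑ i, (n : ℝ) / 2 * (Real.cosh (scale d * dev x i) - 1) := by
          rw [← Finset.mul_sum, Finset.sum_sub_distrib, potential]
          simp
      _ ≤ _ := Finset.sum_le_sum fun i _ => by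
          refine le_trans ?_ (half_mul_abs_sinh_le_sum (y := fun j => scale d * dev x j)
            (by rw [← Finset.mul_sum, sum_dev, mul_zero]) i)
          refine mul_le_mul_of_nonneg_left ?_ (by positivity)
          have h4 := Real.cosh_sq (scale d * dev x i)
          have h5 := Real.cosh_pos (scale d * dev x i)
          rw [sub_le_iff_le_add]
          refine abs_le_of_sq_le_sq' ?_ (by positivity) |>.2
          rw [h4, add_sq, sq_abs]
          nlinarith [abs_nonneg (Real.sinh (scale d * dev x i))]
  have h4 : ∑ i, (binProb d x i - 1 / n) * Real.sinh (scale d * dev x i)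
      ≤ -(min 1 (d - 1) / (2 * n ^ 2)) * ((n : ℝ) / 2 * (potential (scale d) x - n)) :=
    h2.trans (mul_le_mul_of_nonpos_left h3 (by
      have : 0 < min 1 (d - 1) / (2 * (n : ℝ) ^ 2) := by positivity
      linarith))
  have h5 := mul_le_mul_of_nonneg_left h4 ha.le
  have h6 : scale d ^ 2 * ((d + 1) / n) = rate d / n := by
    rw [rate, scale]
    have : d + 1 ≠ 0 := by linarith
    field_simp
  have h7 : scale d * (-(min 1 (d - 1) / (2 * n ^ 2))
      * ((n : ℝ) / 2 * (potential (scale d) x - n)))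
      = -(2 * (rate d / n)) * potential (scale d) x + 2 * rate d := by
    rw [rate]
    field_simp
    ring
  rw [h6] at h1
  rw [h7] at h5
  linarith

/-- The bound `2 * n` is the fixed point of the drift, and the potential starts at `n`. -/
theorem step_iterate_potential_le (hd : 1 < d) (m : ℕ) :
    (step d)^[m] (potential (scale d)) (0 : Fin n → ℕ) ≤ 2 * n := by
  have hn : (1 : ℝ) ≤ n := by exact_mod_cast Nat.one_le_iff_ne_zero.mpr (NeZero.ne n)
  have hn0 : (0 : ℝ) < n := by linarith
  have hr : 0 ≤ 1 - rate d / n := by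
    have : rate d / n ≤ 1 := (div_le_one hn0).mpr ((rate_le_one hd).trans hn)
    linarith
  induction m with
  | zero =>
    simp [potential, dev]
    linarith
  | succ m ih =>
    rw [Function.iterate_succ_apply]
    refine (step_iterate_mono hd m fun y _ => step_potential_le hd y).trans ?_
    rw [step_iterate_add m (fun y => (1 - rate d / n) * potential (scale d) y),
      step_iterate_const_mul, step_iterate_const hd]
    have h1 := mul_le_mul_of_nonneg_left ih hr
    have h2 : (1 - rate d / n) * (2 * n) + 2 * rate d = 2 * n := by
      field_simp
      ring
    linarith

end Potential

/-! ### Layered induction -/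

/-- The number of bins with at least `h` balls. -/
def numGE {n : ℕ} (h : ℕ) (x : Fin n → ℕ) : ℕ :=
  (univ.filter fun i => h ≤ x i).card

section Layers

variable {d : ℝ} {n : ℕ}

theorem numGE_le_update (h : ℕ) (x : Fin n → ℕ) (i : Fin n) :
    numGE h x ≤ numGE h (Function.update x i (x i + 1)) := by
  refine Finset.card_le_card fun j hj => ?_
  simp only [Finset.mem_filter, Finset.mem_univ, true_and, Function.update_apply] at hj ⊢
  split_ifs with hji
  · subst hji
    omega
  · exact hj

theorem numGE_succ_update_le (h : ℕ) (x : Fin n → ℕ) (i : Fin n) :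
    numGE (h + 1) (Function.update x i (x i + 1))
      ≤ numGE (h + 1) x + if h ≤ x i then 1 else 0 := by
  split_ifs with hi
  · refine le_trans (Finset.card_le_card fun j hj => ?_) (Finset.card_insert_le i _)
    simp only [Finset.mem_filter, Finset.mem_univ, true_and, Function.update_apply,
      Finset.mem_insert] at hj ⊢
    by_cases hji : j = i
    · exact Or.inl hji
    · rw [if_neg hji] at hj
      exact Or.inr hj
  · rw [add_zero]
    refine Finset.card_le_card fun j hj => ?_
    simp only [Finset.mem_filter, Finset.mem_univ, true_and, Function.update_apply] at hj ⊢
    by_cases hji : j = i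
    · rw [if_pos hji] at hj
      omega
    · rwa [if_neg hji] at hj

theorem numGE_antitone (x : Fin n → ℕ) : Antitone fun h => numGE h x := fun _ _ hh =>
  Finset.card_le_card fun _ hj => by
    simp only [Finset.mem_filter, Finset.mem_univ, true_and] at hj ⊢
    omega

/-- The next ball lands on a bin with at least `h` balls with probability `(numGE h x / n) ^ d`,
because these bins have the ranks `1, …, numGE h x`. -/
theorem sum_binProb_filter (hd : 1 < d) [NeZero n] (h : ℕ) (x : Fin n → ℕ) :
    ∑ i, (if h ≤ x i then binProb d x i else 0) = ((numGE h x : ℝ) / n) ^ d := by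
  have h1 : ∀ i, h ≤ x i ↔ rank x i ≤ numGE h x := by
    intro i
    constructor
    · intro hi
      refine Finset.card_le_card fun j hj => ?_
      simp only [Finset.mem_filter, Finset.mem_univ, true_and] at hj ⊢
      omega
    · intro hi
      by_contra hlt
      refine absurd hi (not_le.mpr (Finset.card_lt_card ?_))
      refine Finset.ssubset_iff_of_subset (fun j hj => ?_) |>.mpr ⟨i, by simp, by simpa using hlt⟩
      simp only [Finset.mem_filter, Finset.mem_univ, true_and] at hj ⊢
      omega
  simp only [h1]
  have hle : numGE h x ≤ n := by
    simpa [numGE] using Finset.card_le_univ (univ.filter fun i => h ≤ x i)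
  have h2 := sum_comp_rank x fun r => if r ≤ numGE h x then
    ((r : ℝ) / n) ^ d - (((r : ℝ) - 1) / n) ^ d else 0
  have h3 : (Icc 1 n).filter (fun r => r ≤ numGE h x) = Ico (0 + 1) (numGE h x + 1) := by
    ext r
    simp only [Finset.mem_filter, Finset.mem_Icc, Finset.mem_Ico]
    omega
  rw [← Finset.sum_filter (s := Icc 1 n), h3, ← Finset.sum_Ico_add', ← Finset.range_eq_Ico] at h2
  have h4 := Finset.sum_range_sub (fun r : ℕ => ((r : ℝ) / n) ^ d) (numGE h x)
  simp only [Nat.cast_add, Nat.cast_one, add_sub_cancel_right, Nat.cast_zero, zero_div,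
    Real.zero_rpow (show d ≠ 0 by linarith), sub_zero] at h2 h4
  rw [h4] at h2
  exact h2

/-- The number of bins with more than `h` balls, as long as at most `β` bins have `h` balls. -/
def cutNumGE (β : ℝ) (h : ℕ) (x : Fin n → ℕ) : ℝ :=
  if (numGE h x : ℝ) ≤ β then (numGE (h + 1) x : ℝ) else 0

theorem step_cutNumGE_le (hd : 1 < d) [NeZero n] {β : ℝ} (hβ : 0 ≤ β) (h : ℕ) (x : Fin n → ℕ) :
    step d (cutNumGE β h) x ≤ cutNumGE β h x + (β / n) ^ d := by
  have hβn : 0 ≤ (β / n) ^ d := by positivity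
  by_cases hx : (numGE h x : ℝ) ≤ β
  · have h1 : ∀ i, cutNumGE β h (Function.update x i (x i + 1))
        ≤ numGE (h + 1) x + if h ≤ x i then 1 else 0 := by
      intro i
      have h2 : ((numGE (h + 1) (Function.update x i (x i + 1)) : ℕ) : ℝ)
          ≤ numGE (h + 1) x + if h ≤ x i then 1 else 0 := by
        exact_mod_cast numGE_succ_update_le h x i
      rw [cutNumGE]
      split_ifs at h2 ⊢ <;> first | exact h2 | positivity
    calc step d (cutNumGE β h) x
        ≤ ∑ i, binProb d x i * (numGE (h + 1) x + if h ≤ x i then 1 else 0) :=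
          Finset.sum_le_sum fun i _ => mul_le_mul_of_nonneg_left (h1 i) (binProb_nonneg hd x i)
      _ = numGE (h + 1) x + ((numGE h x : ℝ) / n) ^ d := by
          simp only [mul_add, Finset.sum_add_distrib, ← Finset.sum_mul, sum_binProb hd, one_mul,
            mul_ite, mul_one, mul_zero]
          rw [sum_binProb_filter hd]
      _ ≤ _ := by
          rw [cutNumGE, if_pos hx]
          gcongr
  · have h1 : step d (cutNumGE β h) x = 0 := Finset.sum_eq_zero fun i _ => by
      rw [cutNumGE, if_neg, mul_zero]
      intro hle
      exact hx (le_trans (by exact_mod_cast numGE_le_update h x i) hle)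
    rw [h1, cutNumGE, if_neg hx]
    linarith

theorem step_iterate_cutNumGE_le (hd : 1 < d) [NeZero n] {β : ℝ} (hβ : 0 ≤ β) (h m : ℕ)
    (x : Fin n → ℕ) :
    (step d)^[m] (cutNumGE β h) x ≤ cutNumGE β h x + m * (β / n) ^ d := by
  induction m generalizing x with
  | zero => simp
  | succ m ih =>
    rw [Function.iterate_succ_apply]
    refine (step_iterate_mono hd m fun y _ => step_cutNumGE_le hd hβ h y).trans ?_
    rw [step_iterate_add m (cutNumGE β h), step_iterate_const hd]
    have := ih x
    push_cast
    linarith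

/-- The indicator function of the event that more than `β` bins have at least `h` balls. -/
def manyGE (β : ℝ) (h : ℕ) (x : Fin n → ℕ) : ℝ :=
  if β < numGE h x then 1 else 0

theorem manyGE_succ_le {β β' : ℝ} (hβ' : 0 < β') (h : ℕ) (x : Fin n → ℕ) :
    manyGE β' (h + 1) x ≤ manyGE β h x + β'⁻¹ * cutNumGE β h x := by
  have h1 : 0 ≤ cutNumGE β h x := by
    rw [cutNumGE]
    split_ifs <;> positivity
  have h3 : 0 ≤ β'⁻¹ * cutNumGE β h x := by positivity
  by_cases hx : β < numGE h x
  · have h2 : manyGE β' (h + 1) x ≤ 1 := by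
      rw [manyGE]
      split_ifs <;> norm_num
    rw [manyGE.eq_def β, if_pos hx]
    linarith
  · rw [manyGE.eq_def β, if_neg hx, zero_add]
    by_cases hx' : β' < numGE (h + 1) x
    · rw [manyGE, if_pos hx', cutNumGE, if_pos (not_lt.mp hx), inv_mul_eq_div, one_le_div hβ']
      exact hx'.le
    · rw [manyGE, if_neg hx']
      exact h3

/-- One layer: a Markov bound for the number of bins with `h + 1` balls, given that at most `β`
bins reach `h` balls. Initially there must be no bin with `h + 1` balls. -/
theorem step_iterate_manyGE_succ_le (hd : 1 < d) [NeZero n] {β β' : ℝ} (hβ : 0 ≤ β)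
    (hβ' : 0 < β') (h m : ℕ) {x : Fin n → ℕ} (hx : numGE (h + 1) x = 0) :
    (step d)^[m] (manyGE β' (h + 1)) x
      ≤ (step d)^[m] (manyGE β h) x + m * (β / n) ^ d / β' := by
  refine (step_iterate_mono hd m fun y _ => manyGE_succ_le (β := β) hβ' h y).trans ?_
  rw [step_iterate_add m (manyGE β h), step_iterate_const_mul]
  have h1 := step_iterate_cutNumGE_le hd hβ h m x
  have h2 : cutNumGE β h x = 0 := by simp [cutNumGE, hx]
  rw [h2, zero_add] at h1
  have h3 := mul_le_mul_of_nonneg_left h1 (inv_nonneg.mpr hβ'.le)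
  rw [inv_mul_eq_div β' (m * _)] at h3
  simpa using h3

theorem step_iterate_manyGE_le (hd : 1 < d) [NeZero n] {β : ℕ → ℝ} (hβ : ∀ i, 0 < β i) {ε : ℝ}
    {m : ℕ} (hε : ∀ i, m * (β i / n) ^ d / β (i + 1) ≤ ε) (h k : ℕ) {x : Fin n → ℕ}
    (hx : numGE h x = 0) :
    (step d)^[m] (manyGE (β k) (h + k)) x ≤ (step d)^[m] (manyGE (β 0) h) x + k * ε := by
  induction k with
  | zero => simp
  | succ k ih =>
    have h1 := step_iterate_manyGE_succ_le hd (hβ k).le (hβ (k + 1)) (h + k) m (x := x)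
      (Nat.le_zero.mp ((numGE_antitone x (by omega : h ≤ h + k + 1)).trans_eq hx))
    have h2 := hε k
    rw [← add_assoc]
    push_cast
    linarith

end Layers

/-- The probability that after `t * n` balls the gap is at least the integer `l`, that is, that some
bin has at least `t + l` balls. -/
def gapProb (d : ℝ) (n t l : ℕ) : ℝ :=
  (step d)^[t * n] (manyGE 0 (t + l)) (0 : Fin n → ℕ)

section Gap

variable {d : ℝ} {n : ℕ} [NeZero n]

theorem dev_eq_of_sum_eq {t : ℕ} {y : Fin n → ℕ} (hy : ∑ j, y j = t * n) (i : Fin n) :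
    dev y i = y i - t := by
  have hn : (n : ℝ) ≠ 0 := by exact_mod_cast NeZero.ne n
  have h : ∑ j, (y j : ℝ) = t * n := by exact_mod_cast hy
  rw [dev, h, mul_div_cancel_right₀ _ hn]

theorem gapTail_le_gapProb (hd : 1 < d) {t l : ℕ} {s : ℝ} (hs : (l : ℝ) ≤ s) :
    gapTail hd n t s ≤ gapProb d n t l := by
  rw [gapTail, loadLaw_toMeasure_real]
  refine step_iterate_mono hd _ fun y hy => ?_
  rw [manyGE]
  by_cases hys : s ≤ gap y
  · rw [Set.indicator_of_mem (by exact hys), if_pos]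
    obtain ⟨i, -, hi⟩ := Finset.exists_mem_eq_sup (univ : Finset (Fin n)) univ_nonempty y
    have h1 := dev_eq_of_sum_eq (t := t) (by simpa using hy) i
    have h2 : gap y = dev y i := by rw [gap, hi, dev]
    have h3 : ((t + l : ℕ) : ℝ) ≤ y i := by
      push_cast
      linarith
    exact_mod_cast Finset.card_pos.mpr ⟨i, by simpa using (by exact_mod_cast h3 : t + l ≤ y i)⟩
  · rw [Set.indicator_of_notMem (by exact hys)]
    split_ifs <;> norm_num

/-- The potential bounds the expected number of bins far above the average. -/
theorem step_iterate_numGE_le (hd : 1 < d) (t l : ℕ) :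
    (step d)^[t * n] (fun y => (numGE (t + l) y : ℝ)) (0 : Fin n → ℕ)
      ≤ 4 * n * Real.exp (-(scale d * l)) := by
  have h1 : (step d)^[t * n] (fun y => (numGE (t + l) y : ℝ)) (0 : Fin n → ℕ)
      ≤ (step d)^[t * n] (fun y => 2 * Real.exp (-(scale d * l)) * potential (scale d) y)
          (0 : Fin n → ℕ) := by
    refine step_iterate_mono hd _ fun y hy => ?_
    have hy' : ∑ j, y j = t * n := by simpa using hy
    rw [numGE, ← Finset.sum_boole, potential, Finset.mul_sum]
    refine Finset.sum_le_sum fun i _ => ?_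
    split_ifs with hi
    · have hi' : ((t + l : ℕ) : ℝ) ≤ y i := by exact_mod_cast hi
      have h2 : (l : ℝ) ≤ dev y i := by
        rw [dev_eq_of_sum_eq hy']
        push_cast at hi'
        linarith
      have h3 : Real.exp (scale d * l) ≤ Real.exp (scale d * dev y i) :=
        Real.exp_le_exp.mpr (mul_le_mul_of_nonneg_left h2 (scale_pos hd).le)
      have h4 : Real.exp (scale d * l) ≤ 2 * Real.cosh (scale d * dev y i) := by
        rw [Real.cosh_eq]
        have := Real.exp_pos (-(scale d * dev y i))
        linarith
      have h5 := mul_le_mul_of_nonneg_left h4 (Real.exp_pos (-(scale d * l))).le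
      rw [← Real.exp_add, neg_add_cancel, Real.exp_zero] at h5
      linarith
    · have := Real.cosh_pos (scale d * dev y i)
      positivity
  refine h1.trans ?_
  rw [step_iterate_const_mul]
  have h2 := mul_le_mul_of_nonneg_left (step_iterate_potential_le (n := n) hd (t * n))
    (by positivity : 0 ≤ 2 * Real.exp (-(scale d * l)))
  linarith

theorem gapProb_le_exp (hd : 1 < d) (t l : ℕ) :
    gapProb d n t l ≤ 4 * n * Real.exp (-(scale d * l)) := by
  refine le_trans (step_iterate_mono hd _ fun y _ => ?_) (step_iterate_numGE_le hd t l)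
  rw [manyGE]
  split_ifs with h
  · exact_mod_cast h
  · positivity

theorem step_iterate_manyGE_le_exp (hd : 1 < d) (t l : ℕ) {β : ℝ} (hβ : 0 < β) :
    (step d)^[t * n] (manyGE β (t + l)) (0 : Fin n → ℕ)
      ≤ 4 * n * Real.exp (-(scale d * l)) / β := by
  rw [← inv_mul_eq_div]
  refine le_trans ?_ (mul_le_mul_of_nonneg_left (step_iterate_numGE_le (n := n) hd t l)
    (inv_nonneg.mpr hβ.le))
  have h1 := congrFun (step_iterate_const_mul (d := d) (t * n) β⁻¹
    fun y : Fin n → ℕ => (numGE (t + l) y : ℝ)) 0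
  rw [← h1]
  refine step_iterate_mono hd _ fun y _ => ?_
  rw [manyGE]
  split_ifs with h
  · rw [inv_mul_eq_div, one_le_div hβ]
    exact h.le
  · positivity

/-- Layered induction over the last `L * n` balls. A gap below `L` before these balls means that no
bin had reached the final average load by then, so all the balls above it are among them. The
sizes `2 ^ (-d ^ i) * n / R` of the layers are such that each layer fails with probability at most
`1 / K`, and the `k`-th one is empty. -/
theorem gapProb_add_le (hd : 1 < d) {K : ℝ} (hK : 1 < K) {L t : ℕ} (hL : 1 ≤ L) (hLt : L ≤ t)
    (l : ℕ) {k : ℕ} (hk : (n : ℝ) ≤ 2 ^ (d ^ k)) :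
    gapProb d n t (l + k) ≤ gapProb d n (t - L) L
      + 8 * (K * L) ^ (1 / (d - 1)) * Real.exp (-(scale d * l)) + k * (1 / K) := by
  have hn0 : (0 : ℝ) < n := by exact_mod_cast Nat.pos_of_ne_zero (NeZero.ne n)
  have hL' : (1 : ℝ) ≤ L := by exact_mod_cast hL
  have hd1 : 0 < d - 1 := by linarith
  have hKL : 1 < K * L := by nlinarith
  set R : ℝ := (K * L) ^ (1 / (d - 1)) with hR
  have hR1 : 1 < R := Real.one_lt_rpow hKL (by positivity)
  have hR0 : 0 < R := by linarith
  have hRpow : R ^ d = R * (K * L) := by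
    rw [show d = 1 + (d - 1) by ring, Real.rpow_add hR0, Real.rpow_one, hR,
      ← Real.rpow_mul (by linarith)]
    rw [one_div_mul_cancel hd1.ne', Real.rpow_one]
  set β : ℕ → ℝ := fun i => n / ((2 : ℝ) ^ (d ^ i) * R) with hβdef
  have hβ : ∀ i, 0 < β i := fun i => by positivity
  have hε : ∀ i, ((L * n : ℕ) : ℝ) * (β i / n) ^ d / β (i + 1) ≤ 1 / K := by
    intro i
    refine le_of_eq ?_
    have h1 : β i / n = ((2 : ℝ) ^ (d ^ i) * R)⁻¹ := by
      simp only [hβdef]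
      field_simp
    have h2 : ((2 : ℝ) ^ (d ^ i)) ^ d = 2 ^ (d ^ (i + 1)) := by
      rw [← Real.rpow_mul (by norm_num), pow_succ]
    rw [h1, Real.inv_rpow (by positivity), Real.mul_rpow (by positivity) hR0.le, h2, hRpow]
    simp only [hβdef]
    push_cast
    field_simp
  have hβk : β k < 1 := by
    simp only [hβdef]
    rw [div_lt_one (by positivity)]
    have : (0 : ℝ) < 2 ^ (d ^ k) := by positivity
    nlinarith
  -- Markov property at the start of the last `L` rounds: layered induction from the configurations
  -- with no bin at height `t + l`, and the trivial bound `1` from the others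
  have h1 : ∀ y : Fin n → ℕ, (step d)^[L * n] (manyGE (β k) (t + l + k)) y
      ≤ (manyGE 0 (t + l) y + (step d)^[L * n] (manyGE (β 0) (t + l)) y) + k * (1 / K) := by
    intro y
    by_cases hy : numGE (t + l) y = 0
    · have := step_iterate_manyGE_le hd hβ hε (t + l) k hy
      simpa [manyGE, hy] using this
    · have h2 : (step d)^[L * n] (manyGE (β k) (t + l + k)) y ≤ 1 := by
        refine (step_iterate_mono hd _ (G := fun _ => 1) fun y _ => ?_).trans_eq
          (by rw [step_iterate_const hd])
        rw [manyGE]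
        split_ifs <;> norm_num
      have h3 : 0 ≤ (step d)^[L * n] (manyGE (β 0) (t + l)) y := by
        refine le_trans (by rw [step_iterate_const hd])
          (step_iterate_mono hd _ (F := fun _ => 0) fun y _ => ?_)
        rw [manyGE]
        split_ifs <;> norm_num
      have h4 : manyGE 0 (t + l) y = 1 := by
        rw [manyGE, if_pos (by exact_mod_cast Nat.pos_of_ne_zero hy)]
      have h5 : 0 ≤ (k : ℝ) * (1 / K) := by positivity
      linarith
  have hsplit : t * n = (t - L) * n + L * n := by
    rw [← add_mul, Nat.sub_add_cancel hLt]
  have h2 : gapProb d n t (l + k)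
      ≤ (step d)^[(t - L) * n] ((step d)^[L * n] (manyGE (β k) (t + l + k)))
          (0 : Fin n → ℕ) := by
    rw [← Function.iterate_add_apply, ← hsplit, gapProb, ← add_assoc]
    refine step_iterate_mono hd _ fun y _ => ?_
    rw [manyGE, manyGE]
    by_cases hy : 0 < numGE (t + l + k) y
    · have : (1 : ℝ) ≤ numGE (t + l + k) y := by exact_mod_cast hy
      rw [if_pos (by linarith), if_pos (by linarith)]
    · rw [if_neg (by exact_mod_cast hy)]
      split_ifs <;> norm_num
  have h3 := step_iterate_mono hd ((t - L) * n) (x := (0 : Fin n → ℕ)) fun y _ => h1 y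
  rw [step_iterate_add ((t - L) * n)
      (fun y => manyGE 0 (t + l) y + (step d)^[L * n] (manyGE (β 0) (t + l)) y),
    step_iterate_add ((t - L) * n) (manyGE 0 (t + l)), step_iterate_const hd] at h3
  have h4 : (step d)^[(t - L) * n] (fun y => (step d)^[L * n] (manyGE (β 0) (t + l)) y)
      (0 : Fin n → ℕ) ≤ 8 * R * Real.exp (-(scale d * l)) := by
    have h5 := step_iterate_manyGE_le_exp (n := n) hd t l (hβ 0)
    have h6 := congrFun (Function.iterate_add_apply (step d) ((t - L) * n) (L * n)
      (manyGE (β 0) (t + l))) (0 : Fin n → ℕ)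
    rw [← hsplit] at h6
    rw [← h6]
    refine h5.trans_eq ?_
    simp only [hβdef, pow_zero, Real.rpow_one]
    field_simp
    norm_num
  have h5 : (step d)^[(t - L) * n] (manyGE 0 (t + l)) (0 : Fin n → ℕ)
      ≤ gapProb d n (t - L) L := by
    rw [gapProb, Nat.sub_add_cancel hLt]
    refine step_iterate_mono hd _ fun y _ => ?_
    have h6 := numGE_antitone y (by omega : t ≤ t + l)
    have h7 : (numGE (t + l) y : ℝ) ≤ numGE t y := by exact_mod_cast h6
    rw [manyGE, manyGE]
    split_ifs <;> linarith
  linarith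

end Gap

/-! ### Choice of the parameters -/

/-- The height above the average at which the layered induction over the last `L * n` balls may
start, if failure probabilities of order `x ^ (-6)` are allowed. It is the least integer `l` with
`8 * (x ^ 6 * L) ^ (1 / (d - 1)) * exp (-scale d * l) ≤ x ^ (-6)`. -/
def baseHeight (d x : ℝ) (L : ℕ) : ℕ :=
  ⌈Real.log (8 * (x ^ 6 * L) ^ (1 / (d - 1)) * x ^ 6) / scale d⌉₊

theorem mul_exp_baseHeight_le {d : ℝ} (hd : 1 < d) {x : ℝ} (hx : 1 ≤ x) {L : ℕ} (hL : 1 ≤ L) :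
    8 * (x ^ 6 * L) ^ (1 / (d - 1)) * Real.exp (-(scale d * baseHeight d x L)) ≤ 1 / x ^ 6 := by
  have hx0 : 0 < x := by linarith
  have hL' : (0 : ℝ) < L := by exact_mod_cast hL
  have h1 := Nat.le_ceil (Real.log (8 * (x ^ 6 * L) ^ (1 / (d - 1)) * x ^ 6) / scale d)
  rw [div_le_iff₀ (scale_pos hd)] at h1
  have h2 := Real.exp_le_exp.mpr h1
  have hpos : 0 < 8 * (x ^ 6 * L) ^ (1 / (d - 1)) * x ^ 6 := by positivity
  rw [Real.exp_log hpos] at h2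
  rw [Real.exp_neg, ← div_eq_mul_inv, div_le_div_iff₀ (Real.exp_pos _) (by positivity), one_mul,
    mul_comm (scale d)]
  exact h2

theorem baseHeight_le {d : ℝ} (hd : 1 < d) {x : ℝ} (hx : 1 ≤ x) {L : ℕ} (hL : 1 ≤ L) {y : ℝ}
    (hy : Real.log L ≤ y) :
    (baseHeight d x L : ℝ)
      ≤ (3 + 1 / (d - 1) * (6 * Real.log x + y) + 6 * Real.log x) / scale d + 1 := by
  have hx0 : 0 < x := by linarith
  have hL' : (1 : ℝ) ≤ L := by exact_mod_cast hL
  have hL0 : (0 : ℝ) < L := by linarith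
  have hd1 : 0 < d - 1 := by linarith
  have hlog : Real.log (8 * (x ^ 6 * L) ^ (1 / (d - 1)) * x ^ 6)
      = Real.log 8 + 1 / (d - 1) * (6 * Real.log x + Real.log L) + 6 * Real.log x := by
    rw [Real.log_mul (by positivity) (by positivity), Real.log_mul (by norm_num) (by positivity),
      Real.log_rpow (by positivity), Real.log_mul (by positivity) (by positivity), Real.log_pow]
    norm_num
  have h8 : Real.log 8 ≤ 3 := by
    rw [show (8 : ℝ) = 2 ^ 3 by norm_num, Real.log_pow]
    have := Real.log_two_lt_d9
    norm_num
    linarith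
  have h80 : 0 ≤ Real.log 8 := Real.log_nonneg (by norm_num)
  have hlx : 0 ≤ Real.log x := Real.log_nonneg hx
  have hlL : 0 ≤ Real.log L := Real.log_nonneg hL'
  refine (Nat.ceil_lt_add_one ?_).le.trans ?_
  · rw [hlog]
    exact div_nonneg (by positivity) (scale_pos hd).le
  · rw [hlog]
    have := scale_pos hd
    gcongr
open Filter

/-- Two runs of the layered induction, with failure probability `x ^ (-6)` per layer: over `L₁`
rounds from a logarithmic gap to the gap `L₂`, then over `L₂` rounds to the final gap. -/
theorem gapProb_le_of_two_runs {d : ℝ} (hd : 1 < d) {n : ℕ} [NeZero n] {x : ℝ} (hx : 1 < x)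
    {L₁ L₂ k t : ℕ} (hL₁ : 1 ≤ L₁) (hL₂ : L₂ = baseHeight d x L₁ + k) (hk1 : 1 ≤ k)
    (hk : (n : ℝ) ≤ 2 ^ (d ^ k)) (ht : L₁ + L₂ ≤ t) :
    gapProb d n t (baseHeight d x L₂ + k)
      ≤ 4 * n * Real.exp (-(scale d * L₁)) + 2 * (1 + k) * (1 / x ^ 6) := by
  have hK : 1 < x ^ 6 := one_lt_pow₀ hx (by norm_num)
  have h1 := gapProb_add_le hd hK hL₁ (by omega : L₁ ≤ t - L₂) (baseHeight d x L₁) hk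
  have h2 := gapProb_add_le hd hK (by omega : 1 ≤ L₂) (by omega : L₂ ≤ t) (baseHeight d x L₂) hk
  rw [← hL₂] at h1
  have h3 := mul_exp_baseHeight_le hd hx.le hL₁
  have h4 := mul_exp_baseHeight_le hd hx.le (by omega : 1 ≤ L₂)
  have h5 := gapProb_le_exp (n := n) hd (t - L₂ - L₁) L₁
  linarith

theorem tendsto_logb_logb_atTop :
    Tendsto (fun n : ℕ => Real.logb 2 (Real.logb 2 n)) atTop atTop :=
  (Real.tendsto_logb_atTop one_lt_two).comp
    ((Real.tendsto_logb_atTop one_lt_two).comp tendsto_natCast_atTop_atTop)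

theorem eventually_mul_log_pow_le (C : ℝ) (hC : 0 < C) (m : ℕ) :
    ∀ᶠ n : ℕ in atTop, C * Real.log n ^ m ≤ n := by
  have h := (Real.isLittleO_pow_log_id_atTop (n := m)).def (inv_pos.mpr hC)
  filter_upwards [tendsto_natCast_atTop_atTop.eventually h] with n hn
  have h1 := (le_abs_self _).trans hn
  rw [id, Real.norm_eq_abs, abs_of_nonneg (Nat.cast_nonneg n), inv_mul_eq_div, le_div_iff₀ hC] at h1
  linarith

/-- With `exp O(x)` rounds to go, which is the situation of the first run if `x = log log n`, the
base height is linear in `x`. -/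
theorem baseHeight_le_linear {d : ℝ} (hd : 1 < d) {x : ℝ} (hx : 1 ≤ x) {L : ℕ} (hL : 1 ≤ L)
    {B : ℝ} (hB : 0 ≤ B) (hy : Real.log L ≤ B + x) :
    (baseHeight d x L : ℝ) ≤ (3 + 1 / (d - 1) * (7 + B) + 6) / scale d * x + 1 := by
  have he : 0 < 1 / (d - 1) := one_div_pos.mpr (by linarith)
  have hlog : Real.log x ≤ x := (Real.log_le_sub_one_of_pos (by linarith)).trans (by linarith)
  have h0 := baseHeight_le hd hx hL hy
  generalize 1 / (d - 1) = e at h0 he ⊢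
  refine h0.trans ?_
  rw [div_mul_eq_mul_div (3 + e * (7 + B) + 6)]
  refine add_le_add_left (div_le_div_of_nonneg_right ?_ (scale_pos hd).le) 1
  have h1 : 6 * Real.log x + (B + x) ≤ (7 + B) * x := by nlinarith
  have h2 := mul_le_mul_of_nonneg_left h1 he.le
  linarith

/-- With `O(x)` rounds to go, as in the second run, the base height is logarithmic in `x`. -/
theorem baseHeight_le_log {d : ℝ} (hd : 1 < d) {x : ℝ} (hx : 1 ≤ x) {L : ℕ} (hL : 1 ≤ L)
    {B : ℝ} (hy : Real.log L ≤ B + Real.log x) :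
    (baseHeight d x L : ℝ) ≤ (7 * (1 / (d - 1)) + 6) / scale d * Real.log x
      + ((3 + 1 / (d - 1) * B) / scale d + 1) := by
  refine (baseHeight_le hd hx hL hy).trans_eq ?_
  ring

theorem mul_exp_ceil_log_le {a : ℝ} (ha : 0 < a) {n : ℝ} (hn : 0 < n) :
    4 * n * Real.exp (-(a * ⌈2 / a * Real.log n⌉₊)) ≤ 4 / n := by
  have h1 := Nat.le_ceil (2 / a * Real.log n)
  have h2 : 2 * Real.log n ≤ a * ⌈2 / a * Real.log n⌉₊ := by
    rw [div_mul_eq_mul_div, div_le_iff₀ ha] at h1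
    rw [div_mul_eq_mul_div]
    linarith
  have h3 := Real.exp_le_exp.mpr (neg_le_neg h2)
  have h4 : Real.exp (-(2 * Real.log n)) = (n ^ 2)⁻¹ := by
    rw [Real.exp_neg, two_mul, Real.exp_add, Real.exp_log hn, sq]
  rw [h4] at h3
  calc 4 * n * Real.exp (-(a * ⌈2 / a * Real.log n⌉₊)) ≤ 4 * n * (n ^ 2)⁻¹ := by gcongr
    _ = 4 / n := by field_simp

theorem le_two_rpow_pow_ceil {d : ℝ} (hd : 1 < d) {n : ℝ} (hn : 1 < n) :
    n ≤ 2 ^ (d ^ ⌈Real.logb d (Real.logb 2 n)⌉₊) := by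
  have h1 : Real.logb 2 n ≤ d ^ ⌈Real.logb d (Real.logb 2 n)⌉₊ := by
    rw [← Real.rpow_natCast, ← Real.logb_le_iff_le_rpow hd (Real.logb_pos one_lt_two hn)]
    exact Nat.le_ceil _
  calc n = 2 ^ Real.logb 2 n := (Real.rpow_logb two_pos (by norm_num) (by linarith)).symm
    _ ≤ _ := Real.rpow_le_rpow_of_exponent_le one_le_two h1

end BallsBins

end

theorem mainTheorem2 (d : ℝ) (hd : 1 < d) :
    ∃ α γ : ℝ, ∀ f : ℕ → ℝ,
      Filter.Tendsto (fun n : ℕ => f n / Real.log (n : ℝ)) Filter.atTop Filter.atTop →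
      ∃ N : ℕ, ∀ (n : ℕ) [NeZero n], N ≤ n → ∀ t : ℕ, f n ≤ (t : ℝ) →
        BallsBins.gapTail hd n t
            (Real.logb d (Real.logb 2 n) + α * Real.logb 2 (Real.logb 2 (Real.logb 2 n)) + γ)
          ≤ 2 / (Real.logb 2 (Real.logb 2 n)) ^ 4 := by
  have ha := BallsBins.scale_pos hd
  set a := BallsBins.scale d
  have hlogd : 0 < Real.log d := Real.log_pos hd
  have hlog2 : 0 < Real.log 2 := Real.log_pos one_lt_two
  have hlog2' : Real.log 2 ≤ 1 := by linarith [Real.log_two_lt_d9]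
  have hlog2'' : 1 / 2 ≤ Real.log 2 := by linarith [Real.log_two_gt_d9]
  set e : ℝ := 1 / (d - 1) with he
  have he0 : 0 < e := one_div_pos.mpr (by linarith)
  -- the number of layers is at most `D * x + 1`, where `x` is the twice iterated logarithm of `n`
  set D : ℝ := Real.log 2 / Real.log d with hD
  have hD0 : 0 < D := by positivity
  -- `L₁ ≤ C₁ * logb 2 n` and `L₂ ≤ C₂ * x`
  set C₁ : ℝ := 2 / a + 1 with hC₁
  have hC₁1 : 1 ≤ C₁ := by
    have : 0 < 2 / a := by positivity
    linarith
  have hlC₁ : 0 ≤ Real.log C₁ := Real.log_nonneg hC₁1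
  set Q : ℝ := (3 + e * (7 + Real.log C₁) + 6) / a with hQ
  have hQ0 : 0 < Q := by positivity
  set C₂ : ℝ := Q + D + 2 with hC₂
  have hC₂1 : 1 ≤ C₂ := by linarith
  refine ⟨(7 * e + 6) / a * Real.log 2, (3 + e * Real.log C₂) / a + 2, fun f hf => ?_⟩
  obtain ⟨N, hN⟩ := Filter.eventually_atTop.mp
    ((BallsBins.tendsto_logb_logb_atTop.eventually_ge_atTop (4 + 2 * D)).and
      ((hf.eventually_ge_atTop (2 * (C₁ + C₂))).and
        (BallsBins.eventually_mul_log_pow_le 64 (by norm_num) 4)))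
  refine ⟨max N 2, fun n _ hn t ht => ?_⟩
  obtain ⟨hx4, hfn, hlogn⟩ := hN n (le_trans (le_max_left _ _) hn)
  have hn2 : (2 : ℝ) ≤ n := by exact_mod_cast le_trans (le_max_right _ _) hn
  have hn0 : (0 : ℝ) < n := by linarith
  have hln : 0 < Real.log n := Real.log_pos (by linarith)
  set lam : ℝ := Real.logb 2 n with hlam
  set x : ℝ := Real.logb 2 lam with hx
  have hlam0 : 0 < lam := Real.logb_pos one_lt_two (by linarith)
  have hx1 : 1 < x := by linarith
  have hx0 : 0 < x := by linarith
  have hloglam : Real.log lam = x * Real.log 2 := by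
    rw [hx, Real.logb, div_mul_cancel₀ _ hlog2.ne']
  have hloglamx : Real.log lam ≤ x := by
    rw [hloglam]
    exact mul_le_of_le_one_right hx0.le hlog2'
  have hlogn' : Real.log n = lam * Real.log 2 := by
    rw [hlam, Real.logb, div_mul_cancel₀ _ hlog2.ne']
  have hlamlog : lam ≤ 2 * Real.log n := by
    have := mul_le_mul_of_nonneg_left hlog2'' hlam0.le
    rw [hlogn']
    linarith
  have hxlam : x ≤ lam := by
    have h2 : Real.log lam ≤ lam / 2 := by
      have h3 := Real.log_le_sub_one_of_pos (x := lam / 2) (by positivity)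
      rw [Real.log_div hlam0.ne' two_ne_zero] at h3
      linarith
    have h3 := mul_le_mul_of_nonneg_left hlog2'' hx0.le
    rw [hloglam] at h2
    linarith
  have hlam1 : 1 ≤ lam := by linarith
  set k : ℕ := ⌈Real.logb d lam⌉₊ with hk
  have hlogblam : Real.logb d lam = D * x := by
    rw [Real.logb, hloglam, hD]
    ring
  have hlogblam0 : 0 < Real.logb d lam := by
    rw [hlogblam]
    positivity
  have hkle : (k : ℝ) ≤ D * x + 1 := by
    rw [← hlogblam]
    exact (Nat.ceil_lt_add_one hlogblam0.le).le
  have hk1 : 1 ≤ k := Nat.ceil_pos.mpr hlogblam0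
  have hkn : (n : ℝ) ≤ 2 ^ (d ^ k) := BallsBins.le_two_rpow_pow_ceil hd (by linarith)
  -- the first run: initially the gap is below `L₁` except with probability `4 / n`
  set L₁ : ℕ := ⌈2 / a * Real.log n⌉₊ with hL₁
  have hL₁0 : 0 < 2 / a * Real.log n := by positivity
  have hL₁1 : 1 ≤ L₁ := Nat.ceil_pos.mpr hL₁0
  have hL₁le : (L₁ : ℝ) ≤ C₁ * lam := by
    have h1 : (L₁ : ℝ) ≤ 2 / a * Real.log n + 1 := (Nat.ceil_lt_add_one hL₁0.le).le
    have h2 : Real.log n ≤ lam := by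
      rw [hlogn']
      exact mul_le_of_le_one_right hlam0.le hlog2'
    have h3 : 2 / a * Real.log n ≤ 2 / a * lam := by gcongr
    rw [hC₁]
    linarith
  have hlogL₁ : Real.log L₁ ≤ Real.log C₁ + x := by
    have h1 : (0 : ℝ) < L₁ := by exact_mod_cast hL₁1
    have h2 := Real.log_le_log h1 hL₁le
    rw [Real.log_mul (by linarith) hlam0.ne'] at h2
    linarith
  have hexp : 4 * n * Real.exp (-(a * L₁)) ≤ 4 / n := BallsBins.mul_exp_ceil_log_le ha hn0
  -- the second run: `L₂` is the gap that the first run guarantees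
  set L₂ : ℕ := BallsBins.baseHeight d x L₁ + k with hL₂
  have hL₂le : (L₂ : ℝ) ≤ C₂ * x := by
    have h1 := BallsBins.baseHeight_le_linear hd hx1.le hL₁1 hlC₁ hlogL₁
    have h2 : C₂ * x = Q * x + D * x + 2 * x := by
      rw [hC₂]
      ring
    rw [hL₂, h2]
    push_cast
    linarith
  have hlogL₂ : Real.log L₂ ≤ Real.log C₂ + Real.log x := by
    have h1 : (0 : ℝ) < L₂ := by
      have : 0 < L₂ := by omega
      exact_mod_cast this
    have h2 := Real.log_le_log h1 hL₂le
    rwa [Real.log_mul (by linarith) hx0.ne'] at h2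
  have htL : L₁ + L₂ ≤ t := by
    rw [le_div_iff₀ hln] at hfn
    have h1 : (C₁ + C₂) * lam ≤ (C₁ + C₂) * (2 * Real.log n) := by gcongr
    have h2 : C₂ * x ≤ C₂ * lam := by gcongr
    have h3 : ((L₁ + L₂ : ℕ) : ℝ) ≤ t := by
      push_cast
      linarith
    exact_mod_cast h3
  have hthr : ((BallsBins.baseHeight d x L₂ + k : ℕ) : ℝ) ≤ Real.logb d lam
      + (7 * e + 6) / a * Real.log 2 * Real.logb 2 x + ((3 + e * Real.log C₂) / a + 2) := by
    have h1 := BallsBins.baseHeight_le_log hd hx1.le (by omega : 1 ≤ L₂) hlogL₂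
    have h2 : Real.log 2 * Real.logb 2 x = Real.log x := by
      rw [Real.logb, mul_div_cancel₀ _ hlog2.ne']
    rw [mul_assoc, h2, hlogblam]
    push_cast
    linarith
  refine (BallsBins.gapTail_le_gapProb hd hthr).trans
    ((BallsBins.gapProb_le_of_two_runs hd hx1 hL₁1 hL₂ hk1 hkn htL).trans ?_)
  have hfirst : (4 : ℝ) / n ≤ 1 / x ^ 4 := by
    rw [div_le_div_iff₀ hn0 (by positivity)]
    have h1 : x ^ 4 ≤ (2 * Real.log n) ^ 4 := by
      gcongr
      linarith
    rw [mul_pow] at h1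
    linarith
  have hsecond : 2 * (1 + k) * (1 / x ^ 6) ≤ 1 / x ^ 4 := by
    have h1 : 2 * (1 + (k : ℝ)) ≤ x ^ 2 := by
      have h2 := mul_le_mul_of_nonneg_right hx4 hx0.le
      rw [sq]
      linarith
    calc 2 * (1 + k) * (1 / x ^ 6) ≤ x ^ 2 * (1 / x ^ 6) := by gcongr
      _ = 1 / x ^ 4 := by field_simp
  have hsum : 1 / x ^ 4 + 1 / x ^ 4 = 2 / x ^ 4 := by ring
  linarith
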